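/- Let $(E,+,\le)$ be a non-trivial totally ordered abelian group such that (*) for all $a<b$ in $E$ there is $c\in E$ with $a<c<b$; (**) for all $a,b\in E$, $a\le b \iff a-b\le 0$ (that is, the order is translation invariant); and suppose that $E$, with its order topology, is locally compact and separable. Let $\mu$ be a Haar measure on $E$. For $t\in E$ let $f^t\in L^\infty(\mu)$ be the class of the characteristic function of $\{u\in E: u>t\}$, let $A$ be the unital (norm closed) $C^*$-subalgebra of the complex algebra $L^\infty(\mu)$ generated by $\{f^t: t\in E\}$, and let $K$ be the compact space of characters of $A$ with the weak-$*$ topology. For $\theta\in K$ and $t\in E$ put $\psi(\theta,t)=\theta(f^t)\in\{0,1\}$, and define $\theta_t,\check\theta\in K$ by $\theta_t(g)=\theta(g_t)$ and $\check\theta(g)=\theta(\check g)$ for $g\in A$, where $g_t(u)=g(u-t)$ and $\check g(u)=g(-u)$ for almost every $u\in E$. Let $B_2$ be the set of those $\theta\in K$ for which $t\mapsto\psi(\theta,t)$ is not continuous on $E$ and there is a point $h(\theta)$ in the closure of $\{t\in E:\psi(\theta,t)=0\}$ with $\psi(\theta,h(\theta))=1$. Then the Borel $\sigma$-algebra of $K\times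 K$ (with the product topology) strictly contains $\mathrm{Bor}(K)\otimes\mathrm{Bor}(K)$. More precisely, $B_2\neq\emptyset$, and for every $\theta\in B_2$ the map $E\to K\times K$, $t\mapsto(\theta_t,(\check\theta)_t)$, is measurable from $\mathrm{Bor}(E)$ to $\mathrm{Bor}(K)\otimes\mathrm{Bor}(K)$ but is not measurable from $\mathrm{Bor}(E)$ to $\mathrm{Bor}(K\times K)$. -/

import Mathlib

open MeasureTheory Set
open scoped ENNReal

noncomputable section

namespace OrderedCharacters

/-! ### The commutative C⋆-algebra `L^∞(μ)` -/

section Linf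

variable {α : Type*} [MeasurableSpace α] {μ : Measure α}

/-- Pointwise (a.e.) multiplication on `L^∞(μ)`. -/
instance linfMul : Mul (Lp ℂ ∞ μ) where
  mul f g := ⟨f.1 * g.1, Lp.mem_Lp_iff_memLp.2
    (((Lp.memLp g).mul' (r := ∞) (Lp.memLp f)).ae_eq (AEEqFun.coeFn_mul f.1 g.1).symm)⟩

/-- The constant function `1` in `L^∞(μ)`. -/
instance linfOne : One (Lp ℂ ∞ μ) where
  one := ⟨1, Lp.mem_Lp_iff_memLp.2
    ((memLp_top_const (1 : ℂ)).ae_eq AEEqFun.coeFn_one.symm)⟩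

theorem linf_coeFn_mul (f g : Lp ℂ ∞ μ) : ⇑(f * g) =ᵐ[μ] fun x => f x * g x :=
  AEEqFun.coeFn_mul f.1 g.1

theorem linf_coeFn_one : ⇑(1 : Lp ℂ ∞ μ) =ᵐ[μ] fun _ => (1 : ℂ) :=
  AEEqFun.coeFn_one

theorem linf_ae_norm_le (f : Lp ℂ ∞ μ) : ∀ᵐ x ∂μ, ‖f x‖ ≤ ‖f‖ := by
  have h := ae_le_eLpNormEssSup (f := f) (μ := μ)
  filter_upwards [h] with x hx
  rw [Lp.norm_def, eLpNorm_exponent_top, ← toReal_enorm]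
  refine ENNReal.toReal_mono ?_ hx
  rw [← eLpNorm_exponent_top]
  exact Lp.eLpNorm_ne_top f

theorem linf_norm_le {f : Lp ℂ ∞ μ} {C : ℝ} (hC : 0 ≤ C) (h : ∀ᵐ x ∂μ, ‖f x‖ ≤ C) :
    ‖f‖ ≤ C := by
  rw [Lp.norm_def, eLpNorm_exponent_top]
  exact ENNReal.toReal_le_of_le_ofReal hC (eLpNormEssSup_le_of_ae_bound h)

instance linfNormedCommRing : NormedCommRing (Lp ℂ ∞ μ) :=
  { (inferInstance : NormedAddCommGroup (Lp ℂ ∞ μ)), linfMul, linfOne with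
    mul_assoc := fun f g h => Subtype.ext (mul_assoc f.1 g.1 h.1)
    mul_comm := fun f g => Subtype.ext (mul_comm f.1 g.1)
    one_mul := fun f => Subtype.ext (one_mul f.1)
    mul_one := fun f => Subtype.ext (mul_one f.1)
    left_distrib := fun f g h => by
      apply Lp.ext
      filter_upwards [linf_coeFn_mul f (g + h), Lp.coeFn_add g h, linf_coeFn_mul f g,
        linf_coeFn_mul f h, Lp.coeFn_add (f * g) (f * h)] with x h1 h2 h3 h4 h5
      refine h1.trans (Eq.trans ?_ h5.symm)
      simp only [h2, Pi.add_apply, h3, h4, mul_add]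
    right_distrib := fun f g h => by
      apply Lp.ext
      filter_upwards [linf_coeFn_mul (f + g) h, Lp.coeFn_add f g, linf_coeFn_mul f h,
        linf_coeFn_mul g h, Lp.coeFn_add (f * h) (g * h)] with x h1 h2 h3 h4 h5
      refine h1.trans (Eq.trans ?_ h5.symm)
      simp only [h2, Pi.add_apply, h3, h4, add_mul]
    zero_mul := fun f => by
      apply Lp.ext
      filter_upwards [linf_coeFn_mul 0 f, Lp.coeFn_zero ℂ ∞ μ] with x h1 h2
      refine h1.trans ?_
      rw [h2]; simp
    mul_zero := fun f => by
      apply Lp.ext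
      filter_upwards [linf_coeFn_mul f 0, Lp.coeFn_zero ℂ ∞ μ] with x h1 h2
      refine h1.trans ?_
      rw [h2]; simp
    norm_mul_le := fun f g => by
      refine linf_norm_le (by positivity) ?_
      filter_upwards [linf_coeFn_mul f g, linf_ae_norm_le f, linf_ae_norm_le g] with x h1 h2 h3
      refine (congrArg norm h1).trans_le ?_
      rw [norm_mul]
      gcongr }

instance linfStarRing : StarRing (Lp ℂ ∞ μ) where
  star_mul f g := by
    apply Lp.ext
    filter_upwards [Lp.coeFn_star (f * g), linf_coeFn_mul f g, linf_coeFn_mul (star g) (star f),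
      Lp.coeFn_star f, Lp.coeFn_star g] with x h1 h2 h3 h4 h5
    rw [h1, h3, Pi.star_apply, h2, h4, h5, Pi.star_apply, Pi.star_apply, star_mul]
  star_add f g := by
    apply Lp.ext
    filter_upwards [Lp.coeFn_star (f + g), Lp.coeFn_add f g, Lp.coeFn_add (star f) (star g),
      Lp.coeFn_star f, Lp.coeFn_star g] with x h1 h2 h3 h4 h5
    rw [h1, h3, Pi.star_apply, h2, Pi.add_apply, Pi.add_apply, h4, h5, Pi.star_apply,
      Pi.star_apply, star_add]

instance linfNormedAlgebra : NormedAlgebra ℂ (Lp ℂ ∞ μ) :=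
  { Algebra.ofModule (R := ℂ) (A := Lp ℂ ∞ μ)
      (fun c f g => by
        apply Lp.ext
        filter_upwards [linf_coeFn_mul (c • f) g, Lp.coeFn_smul c f, Lp.coeFn_smul c (f * g),
          linf_coeFn_mul f g] with x h1 h2 h3 h4
        rw [h1, h3, h2, Pi.smul_apply, Pi.smul_apply, h4, smul_mul_assoc])
      (fun c f g => by
        apply Lp.ext
        filter_upwards [linf_coeFn_mul f (c • g), Lp.coeFn_smul c g, Lp.coeFn_smul c (f * g),
          linf_coeFn_mul f g] with x h1 h2 h3 h4
        rw [h1, h3, h2, Pi.smul_apply, Pi.smul_apply, h4, mul_smul_comm]) with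
    norm_smul_le := fun c f => norm_smul_le c f }

instance linfCStarRing : CStarRing (Lp ℂ ∞ μ) where
  norm_mul_self_le f := by
    have h : ‖f‖ ≤ Real.sqrt ‖star f * f‖ := by
      refine linf_norm_le (Real.sqrt_nonneg _) ?_
      filter_upwards [linf_coeFn_mul (star f) f, Lp.coeFn_star f,
        linf_ae_norm_le (star f * f)] with x h1 h2 h3
      rw [h1, h2, Pi.star_apply, CStarRing.norm_star_mul_self] at h3
      exact Real.le_sqrt_of_sq_le (by rw [sq]; exact h3)
    calc ‖f‖ * ‖f‖ ≤ Real.sqrt ‖star f * f‖ * Real.sqrt ‖star f * f‖ := by gcongr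
      _ = ‖star f * f‖ := Real.mul_self_sqrt (norm_nonneg _)

instance linfStarModule : StarModule ℂ (Lp ℂ ∞ μ) where
  star_smul c f := by
    apply Lp.ext
    filter_upwards [Lp.coeFn_star (c • f), Lp.coeFn_smul c f, Lp.coeFn_smul (star c) (star f),
      Lp.coeFn_star f] with x h1 h2 h3 h4
    rw [h1, h3, Pi.star_apply, h2, Pi.smul_apply, Pi.smul_apply, h4, Pi.star_apply, star_smul]

instance linfCommCStarAlgebra : CommCStarAlgebra (Lp ℂ ∞ μ) where

/-- Composition `g ↦ g ∘ φ` with a measure preserving map, as a ⋆-homomorphism of `L^∞(μ)`. -/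
def linfComp (φ : α → α) (hφ : MeasurePreserving φ μ μ) : Lp ℂ ∞ μ →⋆ₐ[ℂ] Lp ℂ ∞ μ where
  toFun := Lp.compMeasurePreserving φ hφ
  map_one' := rfl
  map_mul' := by rintro ⟨⟨_⟩, _⟩ ⟨⟨_⟩, _⟩; rfl
  map_zero' := map_zero _
  map_add' := map_add _
  commutes' c := by
    rw [Algebra.algebraMap_eq_smul_one]
    exact (Lp.compMeasurePreservingₗ ℂ φ hφ).map_smul c 1
  map_star' := by rintro ⟨⟨_⟩, _⟩; rfl

end Linf

/-! ### The compact space `K` of an ordered space with a measure -/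

section Compact

variable {E : Type*} [LinearOrder E] [TopologicalSpace E] [OrderTopology E]
  [MeasurableSpace E] [BorelSpace E]

theorem memLp_rayFun (μ : Measure E) (t : E) :
    MemLp ((Ioi t).indicator fun _ => (1 : ℂ)) ∞ μ :=
  (memLp_top_const (1 : ℂ)).indicator isOpen_Ioi.measurableSet

/-- `f^t`: the class in `L^∞(μ)` of the characteristic function of `{u | t < u}`. -/
def ray (μ : Measure E) (t : E) : Lp ℂ ∞ μ :=
  (memLp_rayFun μ t).toLp _

/-- `A`: the unital (closed) C⋆-subalgebra of `L^∞(μ)` generated by the `f^t`, `t ∈ E`. -/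
def rayAlgebra (μ : Measure E) : StarSubalgebra ℂ (Lp ℂ ∞ μ) :=
  (StarAlgebra.adjoin ℂ (range (ray μ))).topologicalClosure

instance isClosed_rayAlgebra (μ : Measure E) : IsClosed (rayAlgebra μ : Set (Lp ℂ ∞ μ)) :=
  StarSubalgebra.isClosed_topologicalClosure _

theorem ray_mem (μ : Measure E) (t : E) : ray μ t ∈ rayAlgebra μ :=
  StarSubalgebra.le_topologicalClosure _ (StarAlgebra.subset_adjoin ℂ _ (mem_range_self t))

/-- `K`: the space of characters of `A`, with the weak-⋆ topology. -/
abbrev K (μ : Measure E) : Type _ := WeakDual.characterSpace ℂ (rayAlgebra μ)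

/-- `ψ(θ, t) = θ(f^t)`. -/
def psi {μ : Measure E} (θ : K μ) (t : E) : ℂ := θ ⟨ray μ t, ray_mem μ t⟩

/-- The characters `θ` for which `t ↦ ψ(θ, t)` is continuous. -/
def B₁ (μ : Measure E) : Set (K μ) := {θ | Continuous fun t => psi θ t}

/-- `s` is the discontinuity point `h(θ)`: either `s` is adherent to `{ψ(θ, ·) = 0}` and
`ψ(θ, s) = 1`, or `s` is adherent to `{ψ(θ, ·) = 1}` and `ψ(θ, s) = 0`. -/
def IsJump {μ : Measure E} (θ : K μ) (s : E) : Prop :=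
  (s ∈ closure {t | psi θ t = 0} ∧ psi θ s = 1) ∨ (s ∈ closure {t | psi θ t = 1} ∧ psi θ s = 0)

/-- The characters `θ ∉ B₁` with `ψ(θ, h(θ)) = 1`. -/
def B₂ (μ : Measure E) : Set (K μ) := {θ | θ ∉ B₁ μ ∧ ∃ s, IsJump θ s ∧ psi θ s = 1}

/-- A measure preserving map `φ` such that every `f^t ∘ φ` is in `A` induces a
⋆-endomorphism `g ↦ g ∘ φ` of `A`. -/
theorem linfComp_mem {μ : Measure E} (φ : E → E) (hφ : MeasurePreserving φ μ μ)
    (h : ∀ t, linfComp φ hφ (ray μ t) ∈ rayAlgebra μ) (g : rayAlgebra μ) :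
    linfComp φ hφ g ∈ rayAlgebra μ := by
  have hc : Continuous (linfComp φ hφ) := (Lp.isometry_compMeasurePreserving hφ).continuous
  have hcl : IsClosed ((rayAlgebra μ).comap (linfComp φ hφ) : Set (Lp ℂ ∞ μ)) :=
    (isClosed_rayAlgebra μ).preimage hc
  have hle : rayAlgebra μ ≤ (rayAlgebra μ).comap (linfComp φ hφ) := by
    refine StarSubalgebra.topologicalClosure_minimal (StarAlgebra.adjoin_le ?_) hcl
    rintro _ ⟨t, rfl⟩
    exact h t
  exact hle g.2

/-- The ⋆-endomorphism `g ↦ g ∘ φ` of `A`. -/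
def rayComp {μ : Measure E} (φ : E → E) (hφ : MeasurePreserving φ μ μ)
    (h : ∀ t, linfComp φ hφ (ray μ t) ∈ rayAlgebra μ) : rayAlgebra μ →⋆ₐ[ℂ] rayAlgebra μ :=
  ((linfComp φ hφ).comp (rayAlgebra μ).subtype).codRestrict (rayAlgebra μ)
    (linfComp_mem φ hφ h)

end Compact

/-! ### Translation and reflection when `E` is an ordered group with its Haar measure -/

section Group

variable {E : Type*} [AddCommGroup E] [LinearOrder E] [IsOrderedAddMonoid E]
  [TopologicalSpace E] [OrderTopology E] [MeasurableSpace E] [BorelSpace E]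

theorem measurePreserving_shift (μ : Measure E) [μ.IsAddHaarMeasure] (t : E) :
    MeasurePreserving (fun u : E => u - t) μ μ :=
  measurePreserving_sub_right μ t

theorem linfComp_shift_ray (μ : Measure E) [μ.IsAddHaarMeasure] (t s : E) :
    linfComp _ (measurePreserving_shift μ t) (ray μ s) = ray μ (s + t) := by
  have h : ((Ioi s).indicator fun _ => (1 : ℂ)) ∘ (fun u : E => u - t)
      = (Ioi (s + t)).indicator fun _ => (1 : ℂ) := by
    funext u
    simp [indicator, lt_sub_iff_add_lt]
  change Lp.compMeasurePreserving _ _ ((memLp_rayFun μ s).toLp _) = (memLp_rayFun μ (s + t)).toLp _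
  rw [Lp.toLp_compMeasurePreserving]
  exact MemLp.toLp_congr _ _ (Filter.EventuallyEq.of_eq h)

/-- `θ_t(g) = θ(g_t)`, where `g_t(u) = g(u - t)`. -/
def shift {μ : Measure E} [μ.IsAddHaarMeasure] (θ : K μ) (t : E) : K μ :=
  WeakDual.CharacterSpace.compContinuousMap
    (rayComp (fun u => u - t) (measurePreserving_shift μ t)
      (fun s => by rw [linfComp_shift_ray]; exact ray_mem μ (s + t))) θ

theorem shift_apply {μ : Measure E} [μ.IsAddHaarMeasure] (θ : K μ) (t : E) (g : rayAlgebra μ) :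
    shift θ t g = θ (rayComp (fun u => u - t) (measurePreserving_shift μ t)
      (fun s => by rw [linfComp_shift_ray]; exact ray_mem μ (s + t)) g) := rfl

variable [LocallyCompactSpace E] [TopologicalSpace.SeparableSpace E] [DenselyOrdered E]

theorem measurePreserving_reflect (μ : Measure E) [μ.IsAddHaarMeasure] :
    MeasurePreserving (fun u : E => -u) μ μ := by
  have : SecondCountableTopology E := .of_separableSpace_orderTopology E
  exact Measure.measurePreserving_neg μ

variable [Nontrivial E]

theorem linfComp_reflect_ray (μ : Measure E) [μ.IsAddHaarMeasure] (s : E) :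
    linfComp _ (measurePreserving_reflect μ) (ray μ s) = 1 - ray μ (-s) := by
  have : SecondCountableTopology E := .of_separableSpace_orderTopology E
  have hne : ∀ᵐ u ∂μ, u ≠ -s := by
    rw [ae_iff]; simp
  apply Lp.ext
  have h1 := Lp.coeFn_compMeasurePreserving (ray μ s) (measurePreserving_reflect μ)
  have h2 := (measurePreserving_reflect μ).quasiMeasurePreserving.ae_eq_comp
    (memLp_rayFun μ s).coeFn_toLp
  filter_upwards [h1, h2, (memLp_rayFun μ (-s)).coeFn_toLp, Lp.coeFn_sub 1 (ray μ (-s)),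
    linf_coeFn_one (μ := μ), hne] with u k1 k2 k3 k4 k5 k6
  refine k1.trans (k2.trans ?_)
  rw [k4, Pi.sub_apply, k5, show (ray μ (-s)) u = _ from k3]
  rcases lt_or_gt_of_ne k6 with h | h
  · have h' : s < -u := lt_neg.1 h
    simp [h', h.le]
  · have h' : -u ≤ s := (neg_lt.1 h).le
    simp [h, h']

/-- `θˇ(g) = θ(gˇ)`, where `gˇ(u) = g(-u)`. -/
def reflect {μ : Measure E} [μ.IsAddHaarMeasure] (θ : K μ) : K μ :=
  WeakDual.CharacterSpace.compContinuousMap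
    (rayComp (fun u => -u) (measurePreserving_reflect μ)
      (fun s => by
        rw [linfComp_reflect_ray]
        exact sub_mem (one_mem _) (ray_mem μ (-s)))) θ

/-- The map `t ↦ (θ_t, (θˇ)_t)`. -/
def pairMap {μ : Measure E} [μ.IsAddHaarMeasure] (θ : K μ) (t : E) : K μ × K μ :=
  (shift θ t, shift (reflect θ) t)

end Group

end OrderedCharacters

end

/-!
The characters in `B₂` are the right-hand evaluations `g ↦ g(h⁺)`: for them `ψ(θ, ·)` is the
characteristic function of `{s | s ≤ h}`. They exist by compactness, since Gelfand duality yields,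
for each `s > h`, a character with `ψ(θ, h) = 1` and `ψ(θ, s) = 0`. Translation moves `h⁺` to
`(h - t)⁺` and reflection turns it into the left-hand evaluation at `-h`, so `t ↦ θ_t` is left
continuous and `t ↦ (θˇ)_t` is right continuous. Each of the two is therefore Borel measurable,
although neither is continuous. As in the Sorgenfrey plane, combining both one-sided topologies
isolates every point: each `{t}` is the preimage of an open subset of `K × K`, hence so is every
subset of `E`. Since `E` is second countable and has the cardinality of the continuum, some of its
subsets are not Borel.
-/

open Filter Topology
open scoped Cardinal

namespace OrderedCharacters

section NonBorelSets

variable {X : Type*}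

theorem mk_lt_continuum_of_discreteMeasurableSpace [MeasurableSpace X]
    [MeasurableSpace.CountablyGenerated X] [DiscreteMeasurableSpace X] : #X < 𝔠 := by
  obtain ⟨b, hb, hgen⟩ := MeasurableSpace.CountablyGenerated.isCountablyGenerated (α := X)
  have hle := MeasurableSpace.cardinal_measurableSet_le_continuum (s := b)
    (hb.le_aleph0.trans Cardinal.aleph0_le_continuum)
  have huniv : {S : Set X | MeasurableSet S} = univ := eq_univ_of_forall fun _ => .of_discrete
  rw [← hgen, huniv, Cardinal.mk_univ, Cardinal.mk_set] at hle
  exact (Cardinal.cantor #X).trans_le hle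

theorem not_measurable_borel_of_induced_eq_bot {Y : Type*} [MeasurableSpace X]
    [t : TopologicalSpace Y] {f : X → Y} (hX : ¬ DiscreteMeasurableSpace X)
    (hf : t.induced f = ⊥) : ¬ Measurable[_, borel Y] f := by
  refine fun hmeas => hX ⟨fun S => ?_⟩
  obtain ⟨U, hU, rfl⟩ : ∃ U, IsOpen U ∧ f ⁻¹' U = S :=
    isOpen_induced_iff.1 (by rw [hf]; trivial)
  exact hmeas (MeasurableSpace.measurableSet_generateFrom hU)

variable [TopologicalSpace X]

theorem continuum_le_mk_of_uncountable_polishSpace [PolishSpace X] [Uncountable X] : 𝔠 ≤ #X := by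
  obtain ⟨f, -, -, hf⟩ := isClosed_univ.exists_nat_bool_injection_of_not_countable
    (not_countable_univ (α := X))
  simpa using Cardinal.mk_le_of_injective (hf.comp ULift.down_injective)

theorem not_discreteMeasurableSpace_of_isOpenPosMeasure [Nonempty X] [T2Space X]
    [WeaklyLocallyCompactSpace X] [SecondCountableTopology X] [MeasurableSpace X] [BorelSpace X]
    (μ : Measure X) [μ.IsOpenPosMeasure] [NullSingletonClass μ] :
    ¬ DiscreteMeasurableSpace X := by
  intro _
  obtain ⟨C, hC, hCx⟩ := exists_compact_mem_nhds (Classical.arbitrary X)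
  have : Uncountable C := not_countable_iff.1 fun hcount =>
    (Measure.measure_pos_of_mem_nhds μ hCx).ne' (Set.Countable.measure_zero hcount μ)
  have : CompactSpace C := isCompact_iff_compactSpace.1 hC
  let := TopologicalSpace.metrizableSpaceMetric C
  have : PolishSpace C := inferInstance
  exact (continuum_le_mk_of_uncountable_polishSpace.trans (Cardinal.mk_set_le C)).not_gt
    mk_lt_continuum_of_discreteMeasurableSpace

end NonBorelSets

section OneSidedContinuity

variable {E X : Type*} [LinearOrder E] [TopologicalSpace E] [OrderTopology E]
  [TopologicalSpace X]

theorem continuousWithinAt_Iio_indicator_Iic [Zero X] (a x : E) (c : X) :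
    ContinuousWithinAt ((Iic a).indicator fun _ => c) (Iio x) x := by
  rcases le_or_gt x a with hx | hx
  · have heq : EqOn ((Iic a).indicator fun _ => c) (fun _ => c) (Iic x) := fun t ht =>
      indicator_of_mem (mem_Iic.2 (le_trans ht hx)) _
    exact continuousWithinAt_const.congr (heq.mono Iio_subset_Iic_self) (heq self_mem_Iic)
  · have hev : (Iic a).indicator (fun _ => c) =ᶠ[𝓝 x] fun _ => 0 := by
      filter_upwards [Ioi_mem_nhds hx] with t ht
      exact indicator_of_notMem (notMem_Iic.2 ht) _
    exact (continuousAt_const.congr hev.symm).continuousWithinAt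

theorem continuousWithinAt_Ioi_indicator_Iio [Zero X] (a x : E) (c : X) :
    ContinuousWithinAt ((Iio a).indicator fun _ => c) (Ioi x) x := by
  rcases lt_or_ge x a with hx | hx
  · have hev : (Iio a).indicator (fun _ => c) =ᶠ[𝓝 x] fun _ => c := by
      filter_upwards [Iio_mem_nhds hx] with t ht
      exact indicator_of_mem ht _
    exact (continuousAt_const.congr hev.symm).continuousWithinAt
  · have heq : EqOn ((Iio a).indicator fun _ => c) (fun _ => 0) (Ici x) := fun t ht =>
      indicator_of_notMem (notMem_Iio.2 (le_trans hx ht)) _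
    exact continuousWithinAt_const.congr (heq.mono Ioi_subset_Ici_self) (heq self_mem_Ici)

variable [SecondCountableTopology E] [MeasurableSpace E] [BorelSpace E]
  [MeasurableSpace X] [BorelSpace X] {f : E → X}

theorem measurable_of_continuousWithinAt_Ioi (hf : ∀ x, ContinuousWithinAt f (Ioi x) x) :
    Measurable f :=
  measurable_of_isOpen fun _ hU => .of_mem_nhdsGT fun x hx => hf x (hU.mem_nhds hx)

theorem measurable_of_continuousWithinAt_Iio (hf : ∀ x, ContinuousWithinAt f (Iio x) x) :
    Measurable f :=
  measurable_of_continuousWithinAt_Ioi (E := Eᵒᵈ) hf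

end OneSidedContinuity

section Characters

variable {E : Type*} [LinearOrder E] [TopologicalSpace E] [OrderTopology E]
  [MeasurableSpace E] [BorelSpace E] {μ : Measure E}

theorem ray_ae_eq (t : E) : ray μ t =ᵐ[μ] (Ioi t).indicator fun _ => (1 : ℂ) :=
  (memLp_rayFun μ t).coeFn_toLp

theorem ray_mul_ray (s t : E) : ray μ s * ray μ t = ray μ (max s t) := by
  apply Lp.ext
  filter_upwards [linf_coeFn_mul (ray μ s) (ray μ t), ray_ae_eq (μ := μ) s, ray_ae_eq (μ := μ) t,
    ray_ae_eq (μ := μ) (max s t)] with u hmul hs ht hmax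
  rw [hmul, hs, ht, hmax, ← Ioi_inter_Ioi, ← inter_indicator_mul]
  simp only [mul_one]

theorem ray_injective [DenselyOrdered E] [μ.IsOpenPosMeasure] :
    Function.Injective (ray μ) := by
  refine Function.Injective.of_lt_imp_ne fun s t hst heq => ?_
  have hpos : 0 < μ (Ioo s t) := isOpen_Ioo.measure_pos μ (nonempty_Ioo.2 hst)
  refine hpos.ne' (measure_mono_null (fun u hu => ?_)
    (ae_iff.1 ((ray_ae_eq s).symm.trans (heq ▸ ray_ae_eq (μ := μ) t))))
  simp [hu.1, hu.2.le]

theorem psi_mul_psi (θ : K μ) (s t : E) : psi θ s * psi θ t = psi θ (max s t) := by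
  rw [psi, psi, ← map_mul]
  exact congrArg θ (Subtype.ext (ray_mul_ray s t))

theorem psi_eq_zero_or_one (θ : K μ) (t : E) : psi θ t = 0 ∨ psi θ t = 1 :=
  IsIdempotentElem.iff_eq_zero_or_one.1 ((psi_mul_psi θ t t).trans (by rw [max_self]))

theorem psi_eq_one_of_le {θ : K μ} {s t : E} (hst : s ≤ t) (ht : psi θ t = 1) :
    psi θ s = 1 := by
  simpa [max_eq_right hst, ht] using psi_mul_psi θ s t

theorem continuous_psi (t : E) : Continuous fun θ : K μ => psi θ t :=
  (WeakDual.eval_continuous _).comp continuous_subtype_val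

theorem psi_injective : Function.Injective (psi : K μ → E → ℂ) := by
  intro θ η h
  refine StarAlgHomClass.ext_topologicalClosure (R := ℂ) (map_continuous θ) (map_continuous η)
    fun x => ?_
  let incl := StarSubalgebra.inclusion
    (StarSubalgebra.le_topologicalClosure (StarAlgebra.adjoin ℂ (range (ray μ))))
  have hcomp : (θ : rayAlgebra μ →⋆ₐ[ℂ] ℂ).comp incl = (η : rayAlgebra μ →⋆ₐ[ℂ] ℂ).comp incl := by
    refine StarAlgHom.ext_adjoin ?_
    rintro ⟨_, _⟩ ⟨t, rfl⟩
    exact congrFun h t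
  exact DFunLike.congr_fun hcomp x

theorem isInducing_psi : IsInducing (psi : K μ → E → ℂ) :=
  ((continuous_pi (continuous_psi (μ := μ))).isClosedEmbedding psi_injective).isInducing

theorem continuousWithinAt_iff_psi {Y : Type*} [TopologicalSpace Y] {f : Y → K μ} {S : Set Y}
    {y : Y} :
    ContinuousWithinAt f S y ↔ ∀ s, ContinuousWithinAt (fun t => psi (f t) s) S y :=
  isInducing_psi.continuousWithinAt_iff.trans continuousWithinAt_pi

theorem exists_psi_ne [DenselyOrdered E] [μ.IsOpenPosMeasure] {s t : E} (hst : s ≠ t) :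
    ∃ θ : K μ, psi θ s ≠ psi θ t := by
  by_contra! h
  have heq := (gelfandStarTransform (rayAlgebra μ)).injective (ContinuousMap.ext h)
  exact hst (ray_injective (congrArg Subtype.val heq))

theorem exists_psi_eq_one_and_psi_eq_zero [DenselyOrdered E] [μ.IsOpenPosMeasure] {s t : E}
    (hst : s < t) : ∃ θ : K μ, psi θ s = 1 ∧ psi θ t = 0 := by
  obtain ⟨θ, hne⟩ := exists_psi_ne (μ := μ) hst.ne
  have ht : psi θ t = 0 := (psi_eq_zero_or_one θ t).resolve_right fun ht =>
    hne ((psi_eq_one_of_le hst.le ht).trans ht.symm)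
  exact ⟨θ, (psi_eq_zero_or_one θ s).resolve_left fun hs => hne (hs.trans ht.symm), ht⟩

end Characters

section RightEvaluation

variable {E : Type*} [LinearOrder E] [TopologicalSpace E] [OrderTopology E]
  [MeasurableSpace E] [BorelSpace E] {μ : Measure E} {θ : K μ} {h : E}

/-- `θ` is the right-hand evaluation `g ↦ g(h⁺)`, so that `h` is the point `h(θ)` of a character
`θ ∈ B₂`. It is encoded by the values `ψ(θ, ·)`, which determine `θ`. -/
def IsRightEvaluation (θ : K μ) (h : E) : Prop :=
  ∀ s, psi θ s = (Iic h).indicator (fun _ => 1) s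

theorem exists_isRightEvaluation [NoMaxOrder E] [DenselyOrdered E] [μ.IsOpenPosMeasure] (h : E) :
    ∃ θ : K μ, IsRightEvaluation θ h := by
  let Z (s : Ioi h) : Set (K μ) := {θ | psi θ h = 1 ∧ psi θ s = 0}
  have hclosed (s : Ioi h) : IsClosed (Z s) :=
    (isClosed_eq (continuous_psi h) continuous_const).inter
      (isClosed_eq (continuous_psi _) continuous_const)
  have hmono : Monotone Z := fun s t hst θ hθ =>
    ⟨hθ.1, (psi_eq_zero_or_one θ t).resolve_right fun ht =>
      zero_ne_one (hθ.2.symm.trans (psi_eq_one_of_le hst ht))⟩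
  obtain ⟨θ, hθ⟩ := IsCompact.nonempty_iInter_of_directed_nonempty_isCompact_isClosed Z
    hmono.directed_ge (fun s => exists_psi_eq_one_and_psi_eq_zero s.2)
    (fun s => (hclosed s).isCompact) hclosed
  rw [mem_iInter] at hθ
  refine ⟨θ, fun s => ?_⟩
  rcases le_or_gt s h with hs | hs
  · obtain ⟨t, ht⟩ := exists_gt h
    rw [indicator_of_mem (mem_Iic.2 hs)]
    exact psi_eq_one_of_le hs (hθ ⟨t, ht⟩).1
  · rw [indicator_of_notMem (notMem_Iic.2 hs)]
    exact (hθ ⟨s, hs⟩).2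

theorem exists_isRightEvaluation_of_mem_B₂ (hθ : θ ∈ B₂ μ) : ∃ h, IsRightEvaluation θ h := by
  obtain ⟨-, h, hjump, hone⟩ := hθ
  have hcl : h ∈ closure {t | psi θ t = 0} :=
    (hjump.resolve_right fun hj => zero_ne_one (hj.2.symm.trans hone)).1
  refine ⟨h, fun s => ?_⟩
  rcases le_or_gt s h with hs | hs
  · rw [indicator_of_mem (mem_Iic.2 hs)]
    exact psi_eq_one_of_le hs hone
  · rw [indicator_of_notMem (notMem_Iic.2 hs)]
    refine (psi_eq_zero_or_one θ s).resolve_right fun hs1 => ?_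
    obtain ⟨u, hus, hu⟩ := mem_closure_iff.1 hcl (Iio s) isOpen_Iio hs
    exact zero_ne_one (hu.symm.trans (psi_eq_one_of_le hus.le hs1))

theorem IsRightEvaluation.mem_B₂ [NoMaxOrder E] [DenselyOrdered E]
    (hθ : IsRightEvaluation θ h) : θ ∈ B₂ μ := by
  have hone : psi θ h = 1 := by simp [hθ h]
  have hzero : {t | psi θ t = 0} = Ioi h := by ext t; simp [hθ t]
  have hcl : h ∈ closure {t | psi θ t = 0} := by
    rw [hzero, closure_Ioi]
    exact self_mem_Ici
  refine ⟨fun hcont => ?_, h, Or.inl ⟨hcl, hone⟩, hone⟩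
  have hclosed : IsClosed {t | psi θ t = 0} := isClosed_eq hcont continuous_const
  rw [hclosed.closure_eq, hzero] at hcl
  exact hcl.false

theorem B₂_nonempty [Nonempty E] [NoMaxOrder E] [DenselyOrdered E] [μ.IsOpenPosMeasure] :
    (B₂ μ).Nonempty :=
  (exists_isRightEvaluation (Classical.arbitrary E)).imp fun _ hθ => hθ.mem_B₂

end RightEvaluation

section PairMap

variable {E : Type*} [AddCommGroup E] [LinearOrder E] [IsOrderedAddMonoid E]
  [TopologicalSpace E] [OrderTopology E] [MeasurableSpace E] [BorelSpace E]
  {μ : Measure E} [μ.IsAddHaarMeasure] {θ : K μ} {h : E}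

theorem psi_shift (θ : K μ) (t s : E) : psi (shift θ t) s = psi θ (s + t) :=
  congrArg θ (Subtype.ext (linfComp_shift_ray μ t s))

theorem IsRightEvaluation.psi_shift_eq_indicator (hθ : IsRightEvaluation θ h) (t s : E) :
    psi (shift θ t) s = (Iic (h - s)).indicator (fun _ => 1) t := by
  simp only [psi_shift, hθ _, indicator, mem_Iic, le_sub_iff_add_le']

theorem IsRightEvaluation.continuousWithinAt_shift (hθ : IsRightEvaluation θ h) (x : E) :
    ContinuousWithinAt (shift θ) (Iio x) x :=
  continuousWithinAt_iff_psi.2 fun s => by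
    simpa only [hθ.psi_shift_eq_indicator] using continuousWithinAt_Iio_indicator_Iic (h - s) x 1

variable [LocallyCompactSpace E] [TopologicalSpace.SeparableSpace E] [DenselyOrdered E]
  [Nontrivial E]

theorem psi_reflect (θ : K μ) (s : E) : psi (reflect θ) s = 1 - psi θ (-s) := by
  have h : psi (reflect θ) s = θ (1 - ⟨ray μ (-s), ray_mem μ (-s)⟩) :=
    congrArg θ (Subtype.ext (linfComp_reflect_ray μ s))
  rw [h, map_sub, map_one, psi]

theorem IsRightEvaluation.psi_shift_reflect_eq_indicator (hθ : IsRightEvaluation θ h) (t s : E) :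
    psi (shift (reflect θ) t) s = (Iio (-h - s)).indicator (fun _ => 1) t := by
  have hiff : t < -h - s ↔ ¬ -(s + t) ≤ h := by
    rw [lt_sub_iff_add_lt', lt_neg, not_le]
  simp only [psi_shift, psi_reflect, hθ _, indicator, mem_Iic, mem_Iio, hiff]
  split_ifs <;> simp

theorem IsRightEvaluation.continuousWithinAt_shift_reflect (hθ : IsRightEvaluation θ h) (x : E) :
    ContinuousWithinAt (shift (reflect θ)) (Ioi x) x :=
  continuousWithinAt_iff_psi.2 fun s => by
    simpa only [hθ.psi_shift_reflect_eq_indicator]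
      using continuousWithinAt_Ioi_indicator_Iio (-h - s) x 1

theorem IsRightEvaluation.induced_pairMap_eq_bot (hθ : IsRightEvaluation θ h) :
    TopologicalSpace.induced (pairMap θ) inferInstance = ⊥ := by
  refine eq_bot_of_singletons_open fun a => ?_
  refine isOpen_induced_iff.2 ⟨{p | psi p.1 (h - a) ≠ 0 ∧ psi p.2 (-h - a) ≠ 1}, ?_, ?_⟩
  · exact (isOpen_ne_fun ((continuous_psi _).comp continuous_fst) continuous_const).inter
      (isOpen_ne_fun ((continuous_psi _).comp continuous_snd) continuous_const)
  · ext t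
    simp [pairMap, hθ.psi_shift_eq_indicator, hθ.psi_shift_reflect_eq_indicator, le_antisymm_iff]

theorem measurable_pairMap (hθ : θ ∈ B₂ μ) :
    Measurable[borel E, (borel (K μ)).prod (borel (K μ))] (pairMap θ) := by
  have : SecondCountableTopology E := .of_separableSpace_orderTopology E
  obtain ⟨h, hh⟩ := exists_isRightEvaluation_of_mem_B₂ hθ
  rw [← BorelSpace.measurable_eq (α := E)]
  borelize (K μ)
  exact (measurable_of_continuousWithinAt_Iio hh.continuousWithinAt_shift).prodMk
    (measurable_of_continuousWithinAt_Ioi hh.continuousWithinAt_shift_reflect)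

theorem not_measurable_pairMap (hθ : θ ∈ B₂ μ) :
    ¬ Measurable[borel E, borel (K μ × K μ)] (pairMap θ) := by
  have : SecondCountableTopology E := .of_separableSpace_orderTopology E
  obtain ⟨h, hh⟩ := exists_isRightEvaluation_of_mem_B₂ hθ
  rw [← BorelSpace.measurable_eq (α := E)]
  exact not_measurable_borel_of_induced_eq_bot (not_discreteMeasurableSpace_of_isOpenPosMeasure μ)
    hh.induced_pairMap_eq_bot

theorem prod_borel_lt_borel_prod :
    (borel (K μ)).prod (borel (K μ)) < borel (K μ × K μ) := by
  have hle : (borel (K μ)).prod (borel (K μ)) ≤ borel (K μ × K μ) := by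
    borelize (K μ)
    exact prod_le_borel_prod
  obtain ⟨θ, hθ⟩ := B₂_nonempty (μ := μ)
  exact hle.lt_of_ne fun heq => not_measurable_pairMap hθ (heq ▸ measurable_pairMap hθ)

end PairMap

end OrderedCharacters

theorem mainTheorem12 {E : Type*} [AddCommGroup E] [LinearOrder E] [IsOrderedAddMonoid E]
    [TopologicalSpace E] [OrderTopology E] [LocallyCompactSpace E]
    [TopologicalSpace.SeparableSpace E] [DenselyOrdered E] [Nontrivial E]
    [MeasurableSpace E] [BorelSpace E] (μ : MeasureTheory.Measure E) [μ.IsAddHaarMeasure] :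
    (borel (OrderedCharacters.K μ)).prod (borel (OrderedCharacters.K μ))
        < borel (OrderedCharacters.K μ × OrderedCharacters.K μ) ∧
      (OrderedCharacters.B₂ μ).Nonempty ∧
      ∀ θ ∈ OrderedCharacters.B₂ μ,
        Measurable[borel E, (borel (OrderedCharacters.K μ)).prod (borel (OrderedCharacters.K μ))]
            (OrderedCharacters.pairMap θ) ∧
          ¬ Measurable[borel E, borel (OrderedCharacters.K μ × OrderedCharacters.K μ)]
            (OrderedCharacters.pairMap θ) :=
  ⟨OrderedCharacters.prod_borel_lt_borel_prod, OrderedCharacters.B₂_nonempty, fun _ hθ =>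
    ⟨OrderedCharacters.measurable_pairMap hθ, OrderedCharacters.not_measurable_pairMap hθ⟩⟩
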